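/- Let $\lambda,\mu,q>0$ be real numbers, put $\rho=\lambda/\mu$, and let $0\le k\le s$ be integers. Let $Q=\{Q(t);t\ge 0\}$ be the queue-length process, with $Q(0)=k$, of either the $M/M/\infty$ queue or the $M/M/s$ queue with arrival rate $\lambda$ and service rate $\mu$; that is, $Q$ is a birth-death process on $\{0,1,2,\dots\}$ (a continuous-time Markov chain with right-continuous paths) with birth rates $\lambda_n=\lambda$ for $n\ge 0$ and death rates, for $n\ge 1$, $\mu_n=n\mu$ (for $M/M/\infty$) or $\mu_n=\min\{n,s\}\mu$ (for $M/M/s$). Let $\tau_s=\inf\{t\ge 0: Q(t)=s\}$, with $e^{-q\tau_s}=0$ if $\tau_s=\infty$, and let $E_k$ denote expectation given $Q(0)=k$. Then $$E_{k}[e^{-q \tau_{s}}] = \frac{\displaystyle\sum_{j=0}^{k}\sum_{m=0}^{k + s - 2j}\binom{k}{j}\binom{k + s - 2j}{m}\frac{\rho^{s-j}(-1)^{m}}{(s-j)!}\,\frac{q}{q + (j+m)\mu}\,M\!\left(1, \tfrac{q}{\mu} + j + m + 1, -\rho\right)}{\displaystyle\sum_{j=0}^{s}\sum_{m=0}^{2(s-j)}\binom{s}{j}\binom{2(s-j)}{m}\frac{\rho^{s-j}(-1)^{m}}{(s-j)!}\,\frac{q}{q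 + (j+m)\mu}\,M\!\left(1, \tfrac{q}{\mu} + j + m + 1, -\rho\right)},$$ where $M$ is Kummer's function, $M(a,b,z)=\sum_{n=0}^{\infty}\frac{(a)_n z^n}{(b)_n\, n!}$, with $(a)_0=1$ and $(a)_n=a(a+1)\cdots(a+n-1)$ for $n\ge 1$. -/

import Mathlib

open MeasureTheory ProbabilityTheory Filter Topology
open scoped NNReal ENNReal Nat

/-- The generator (`Q`-matrix) of the birth-death process on `{0, 1, 2, …}` with birth rates
`birth n` (`n ≥ 0`) and death rates `death n` (`n ≥ 1`); the value `death 0` is ignored. -/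
noncomputable def birthDeathGenerator (birth death : ℕ → ℝ) (i j : ℕ) : ℝ :=
  if j = i + 1 then birth i
  else if j + 1 = i then death i
  else if j = i then -(birth i + if i = 0 then 0 else death i)
  else 0

/-- `p` is the transition semigroup of a continuous-time birth-death process on `ℕ` with the given
rates: a semigroup of Markov kernels (`p t i {j}` is the probability to move from `i` to `j` in
time `t`) such that, for all `i` and `j`, as `h ↓ 0`,
`p h i {j} = δ_{ij} + h * (birthDeathGenerator birth death i j) + o(h)`. -/
structure IsBirthDeathSemigroup (birth death : ℕ → ℝ) (p : ℝ≥0 → Kernel ℕ ℕ) : Prop where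
  isMarkovKernel : ∀ t, IsMarkovKernel (p t)
  zero : p 0 = Kernel.id
  add : ∀ t u, p (t + u) = p u ∘ₖ p t
  rates : ∀ i j : ℕ, Tendsto (fun h : ℝ≥0 => ((p h i).real {j} - if i = j then 1 else 0) / (h : ℝ))
    (𝓝[>] 0) (𝓝 (birthDeathGenerator birth death i j))

/-- Under the probability measure `P`, the `ℕ`-valued process `(Q t)`, `t ≥ 0`, is a birth-death
process with birth rates `birth n` and death rates `death n` started in the state `k`: it has
almost surely right-continuous paths (for the discrete topology of `ℕ`), and it is a
time-homogeneous Markov process (with respect to its own history) whose transition semigroup is one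
of a birth-death process with these rates. -/
structure IsBirthDeathProcess {Ω : Type*} [MeasurableSpace Ω] (birth death : ℕ → ℝ) (k : ℕ)
    (P : Measure Ω) (Q : ℝ≥0 → Ω → ℕ) : Prop where
  measurable : ∀ t, Measurable (Q t)
  rightContinuous : ∀ᵐ ω ∂P, ∀ t, ContinuousWithinAt (fun u => Q u ω) (Set.Ici t) t
  start : ∀ᵐ ω ∂P, Q 0 ω = k
  markov : ∃ p : ℝ≥0 → Kernel ℕ ℕ, IsBirthDeathSemigroup birth death p ∧
    ∀ (t h : ℝ≥0) (A : Set Ω), MeasurableSet[⨆ u ≤ t, MeasurableSpace.comap (Q u) ⊤] A →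
      ∀ i j : ℕ, P (A ∩ {ω | Q t ω = i} ∩ {ω | Q (t + h) ω = j}) =
        P (A ∩ {ω | Q t ω = i}) * p h i {j}

/-- The queue-length process of the `M/M/∞` queue with arrival rate `lam`, service rate `mu` and
`k` customers at time `0`. -/
def IsMMInfQueue {Ω : Type*} [MeasurableSpace Ω] (lam mu : ℝ) (k : ℕ) (P : Measure Ω)
    (Q : ℝ≥0 → Ω → ℕ) : Prop :=
  IsBirthDeathProcess (fun _ => lam) (fun n => (n : ℝ) * mu) k P Q

/-- The queue-length process of the `M/M/s` queue with `s` servers, arrival rate `lam`, service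
rate `mu` and `k` customers at time `0`. -/
def IsMMsQueue {Ω : Type*} [MeasurableSpace Ω] (s : ℕ) (lam mu : ℝ) (k : ℕ) (P : Measure Ω)
    (Q : ℝ≥0 → Ω → ℕ) : Prop :=
  IsBirthDeathProcess (fun _ => lam) (fun n => ((min n s : ℕ) : ℝ) * mu) k P Q

/-- The discount factor `e^{-q t}` of a time `t ∈ [0, ∞]`, with `e^{-q ∞} = 0`. -/
noncomputable def expDiscount (q : ℝ) (t : WithTop ℝ≥0) : ℝ :=
  WithTop.recTopCoe (C := fun _ => ℝ) 0 (fun u : ℝ≥0 => Real.exp (-(q * (u : ℝ)))) t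

/-- Kummer's function `M(a, b, z) = ∑ (a)_n z ^ n / ((b)_n n!)`, where `(a)_n` is the rising
factorial (the series converges absolutely if `b` is not a non-positive integer). -/
noncomputable def kummerM (a b z : ℝ) : ℝ :=
  ∑' n : ℕ, (ascPochhammer ℝ n).eval a * z ^ n / ((ascPochhammer ℝ n).eval b * (n ! : ℝ))

/-! Below `s` both queues have the same rates, so `f k = E_k[e^{-q τ_s}]` should solve `λ (f (k+1) -
f k) + k μ (f (k-1) - f k) = q f k` for `k < s`, with `f s = 1`. The M/M/∞ queue supplies a
solution. There `Q(t)` is a sum of independent Binomial(k, x) and Poisson(ρ (1 - x)) variables with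
`x = e^{-μ t}`, so the Laplace transform in `t` of `P_k(Q(t) = s)` is, up to a constant factor, `F k
= betaExpIntegral (q / μ) ρ (queueWeight ρ k s)`. Integration by parts gives the equation for `F`
(`betaExpIntegral_queueWeight_recurrence`), Euler's integral turns `F` into the double sums
(`sum_kummerM_eq_betaExpIntegral`), and the answer is `F k / F s`.

That the normalised solution `g` is the transform
(`IsBirthDeathProcess.integral_expDiscount_hittingAfter`) is a martingale argument on a time grid of
mesh `h`. Before entrance into `{s, s + 1, …}`, one step changes the mean of the discounted value of
`g` by a discounted `o(h)`; the errors add up to `o(h) / (1 - e^{-q h})`, which tends to 0. Nothing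
known about the paths forces them to enter this set at `s`. Hence `g` is extended beyond `s` by a
constant `c`: the limiting mean is `g k` for `c = 0` and for `c = 1`, and `e^{-q τ_s}` lies between
the two limiting variables, so all three agree almost surely. -/

/-! ### Integrals against the density and Kummer's function -/

/-- The density `x ^ (c - 1) * exp (-r (1 - x))` on `(0, 1)`, integrated against `f`. -/
noncomputable def betaExpIntegral (c r : ℝ) (f : ℝ → ℝ) : ℝ :=
  ∫ x in (0 : ℝ)..1, x ^ (c - 1) * (Real.exp (-r * (1 - x)) * f x)

theorem intervalIntegrable_betaExp {c : ℝ} (hc : 0 < c) (r : ℝ) {f : ℝ → ℝ} (hf : Continuous f) :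
    IntervalIntegrable (fun x : ℝ => x ^ (c - 1) * (Real.exp (-r * (1 - x)) * f x))
      volume 0 1 := by
  apply (intervalIntegral.intervalIntegrable_rpow' (by linarith)).mul_continuousOn
  fun_prop

theorem betaExpIntegral_add {c : ℝ} (hc : 0 < c) (r : ℝ) {f g : ℝ → ℝ} (hf : Continuous f)
    (hg : Continuous g) :
    betaExpIntegral c r (fun x => f x + g x) = betaExpIntegral c r f + betaExpIntegral c r g := by
  unfold betaExpIntegral
  rw [← intervalIntegral.integral_add (intervalIntegrable_betaExp hc r hf)
    (intervalIntegrable_betaExp hc r hg)]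
  congr 1; ext x; ring

theorem betaExpIntegral_const_mul (c r a : ℝ) (f : ℝ → ℝ) :
    betaExpIntegral c r (fun x => a * f x) = a * betaExpIntegral c r f := by
  unfold betaExpIntegral
  rw [← intervalIntegral.integral_const_mul]
  congr 1; ext x; ring

theorem betaExpIntegral_sum {c : ℝ} (hc : 0 < c) (r : ℝ) {ι : Type*} (t : Finset ι)
    {f : ι → ℝ → ℝ} (hf : ∀ i, Continuous (f i)) :
    betaExpIntegral c r (fun x => ∑ i ∈ t, f i x) = ∑ i ∈ t, betaExpIntegral c r (f i) := by
  unfold betaExpIntegral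
  rw [← intervalIntegral.integral_finsetSum fun i _ => intervalIntegrable_betaExp hc r (hf i)]
  congr 1; ext x; simp only [Finset.mul_sum]

theorem betaExpIntegral_pos {c : ℝ} (hc : 0 < c) (r : ℝ) {f : ℝ → ℝ} (hf : Continuous f)
    (hpos : ∀ x, 0 < x → x < 1 → 0 < f x) : 0 < betaExpIntegral c r f := by
  apply intervalIntegral.intervalIntegral_pos_of_pos_on (intervalIntegrable_betaExp hc r hf) _
    one_pos
  rintro x ⟨h0, h1⟩
  have := hpos x h0 h1
  positivity

/-- Integration by parts for the density `x ^ (c - 1) * exp (-r (1 - x))`. -/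
theorem betaExpIntegral_deriv {c : ℝ} (hc : 0 < c) (r : ℝ) {f f' : ℝ → ℝ}
    (hf' : Continuous f') (h : ∀ x, HasDerivAt f (f' x) x) :
    betaExpIntegral c r (fun x => c * f x + (x * f' x + r * (x * f x))) = f 1 := by
  have hf : Continuous f := continuous_iff_continuousAt.2 fun x => (h x).continuousAt
  -- Only interior differentiability is available: for `c < 1` the factor `x ^ c` is continuous but
  -- not differentiable at 0. Its vanishing there removes the lower boundary term.
  have key := intervalIntegral.integral_eq_sub_of_hasDerivAt_of_le (a := 0) (b := 1)
    (f := fun x : ℝ => x ^ c * (Real.exp (-r * (1 - x)) * f x))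
    (f' := fun x : ℝ => x ^ (c - 1) *
      (Real.exp (-r * (1 - x)) * (c * f x + (x * f' x + r * (x * f x)))))
    zero_le_one ?_ ?_ ?_
  · rw [betaExpIntegral, key]
    simp [Real.zero_rpow hc.ne']
  · have : Continuous fun x : ℝ => x ^ c := Real.continuous_rpow_const hc.le
    fun_prop
  · rintro x ⟨h0, -⟩
    have h1 : HasDerivAt (fun x : ℝ => x ^ c) (c * x ^ (c - 1)) x :=
      Real.hasDerivAt_rpow_const (Or.inl h0.ne')
    have h2 : HasDerivAt (fun x : ℝ => Real.exp (-r * (1 - x))) (Real.exp (-r * (1 - x)) * r) x := by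
      have := (((hasDerivAt_id x).const_sub 1).const_mul (-r)).exp
      simpa using this
    refine (h1.fun_mul (h2.fun_mul (h x))).congr_deriv ?_
    have hx : x ^ c = x ^ (c - 1) * x := by
      rw [← Real.rpow_add_one h0.ne']; congr 1; ring
    rw [hx]; ring
  · apply intervalIntegrable_betaExp hc
    fun_prop

theorem betaExpIntegral_pow (c r : ℝ) (a : ℕ) :
    betaExpIntegral c r (fun x => x ^ a) = betaExpIntegral (c + a) r (fun _ => 1) := by
  unfold betaExpIntegral
  apply intervalIntegral.integral_congr_Ioo_of_le zero_le_one
  rintro x ⟨h0, -⟩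
  have : x ^ (c + a - 1) = x ^ (c - 1) * x ^ a := by
    rw [← Real.rpow_add_natCast h0.ne']; congr 1; ring
  simp only [this]; ring

theorem betaExpIntegral_one_recurrence {b : ℝ} (hb : 0 < b) (r : ℝ) :
    b * betaExpIntegral b r (fun _ => 1) + r * betaExpIntegral (b + 1) r (fun _ => 1) = 1 := by
  have h := betaExpIntegral_deriv hb r (f := fun _ => 1) (f' := fun _ => 0) continuous_const
    fun x => hasDerivAt_const x 1
  have h1 := betaExpIntegral_pow b r 1
  simp only [pow_one, Nat.cast_one] at h1
  rw [betaExpIntegral_add hb r (by fun_prop) (by fun_prop)] at h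
  simp only [mul_zero, zero_add, mul_one] at h
  rw [betaExpIntegral_const_mul b r r, h1] at h
  rw [← betaExpIntegral_const_mul b r b]
  simpa using h

theorem factorial_le_ascPochhammer_eval {b : ℝ} (hb : 0 ≤ b) (n : ℕ) :
    (n ! : ℝ) ≤ (ascPochhammer ℝ n).eval (b + 1) := by
  induction n with
  | zero => simp
  | succ n ih =>
    rw [ascPochhammer_succ_eval, Nat.factorial_succ, mul_comm]
    push_cast
    exact mul_le_mul ih (by linarith) (by positivity) ((Nat.cast_nonneg _).trans ih)

/-- Euler's integral for the confluent hypergeometric function `M(1, b + 1, -r)`. -/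
theorem kummerM_one_eq {b r : ℝ} (hb : 0 < b) (hr : 0 ≤ r) :
    kummerM 1 (b + 1) (-r) = b * betaExpIntegral b r (fun _ => 1) := by
  set I : ℝ → ℝ := fun b => betaExpIntegral b r (fun _ => 1) with hI
  set p : ℕ → ℝ := fun n => (ascPochhammer ℝ n).eval (b + 1) with hp
  have p_pos (n) : 0 < p n := ascPochhammer_pos n _ (by linarith)
  have recur (n : ℕ) : (b + n) * I (b + n) + r * I (b + (n + 1 : ℕ)) = 1 := by
    have := betaExpIntegral_one_recurrence (b := b + n) (by positivity) r
    simpa [hI, add_assoc] using this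
  have I_pos (n : ℕ) : 0 < I (b + n) :=
    betaExpIntegral_pos (by positivity) r continuous_const fun _ _ _ => one_pos
  have term_eq (n : ℕ) : (ascPochhammer ℝ n).eval 1 * (-r) ^ n /
      ((ascPochhammer ℝ n).eval (b + 1) * (n ! : ℝ)) = (-r) ^ n / p n := by
    have : (n ! : ℝ) ≠ 0 := by positivity
    rw [ascPochhammer_eval_one]
    have := (p_pos n).ne'
    simp only [hp] at this ⊢
    field_simp
  have bound (n : ℕ) : ‖(-r) ^ n / p n‖ ≤ r ^ n / n ! := by
    rw [norm_div, norm_pow, norm_neg, Real.norm_of_nonneg hr, Real.norm_of_nonneg (p_pos n).le]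
    have := factorial_le_ascPochhammer_eval hb.le n
    gcongr
  have summ : Summable fun n => (-r) ^ n / p n :=
    Summable.of_norm_bounded (Real.summable_pow_div_factorial r) bound
  -- Iterating `recur`, which expresses `I (b + N)` through `I (b + N + 1)`, produces the series
  -- with an explicit remainder.
  have partial_sum (N : ℕ) : ∑ n ∈ Finset.range N, (-r) ^ n / p n =
      b * I b - (-r) ^ N / p N * ((b + N) * I (b + N)) := by
    induction N with
    | zero => simp [hp]
    | succ N ih =>
      have hs : p (N + 1) = p N * (b + (N + 1 : ℕ)) := by
        simp only [hp, ascPochhammer_succ_eval]; push_cast; ring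
      have h1 := (p_pos N).ne'
      have h2 : b + (N + 1 : ℕ) ≠ 0 := by positivity
      rw [Finset.sum_range_succ, ih, hs, eq_sub_of_add_eq (recur N)]
      field_simp
      ring
  have rem : Tendsto (fun N : ℕ => (-r) ^ N / p N * ((b + N) * I (b + N))) atTop (𝓝 0) := by
    refine squeeze_zero_norm (fun N => ?_) (FloorSemiring.tendsto_pow_div_factorial_atTop r)
    rw [norm_mul]
    -- Both terms of `recur` are nonnegative and add up to 1.
    have h1 : ‖(b + N) * I (b + N)‖ ≤ 1 := by
      rw [Real.norm_of_nonneg (mul_nonneg (by positivity) (I_pos N).le)]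
      have := mul_nonneg hr (I_pos (N + 1)).le
      linarith [recur N]
    have := mul_le_mul (bound N) h1 (norm_nonneg _) (by positivity)
    simpa using this
  have lim := summ.hasSum.tendsto_sum_nat
  simp only [partial_sum] at lim
  have := tendsto_nhds_unique lim (tendsto_const_nhds.sub rem)
  rw [sub_zero] at this
  rw [kummerM, ← this]
  exact tsum_congr term_eq

/-! ### Binomial-plus-Poisson weights and their recurrence -/

/-- `exp (r (1 - x))` times the probability that the sum of independent `Binomial(k, x)` and
`Poisson(r (1 - x))` variables is `s`. -/
noncomputable def queueWeight (r : ℝ) (k s : ℕ) (x : ℝ) : ℝ :=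
  PowerSeries.coeff s ((PowerSeries.C x * PowerSeries.X + PowerSeries.C (1 - x)) ^ k *
    PowerSeries.mk fun n => (r * (1 - x)) ^ n / (n ! : ℝ))

theorem queueWeight_zero (r x : ℝ) (s : ℕ) :
    queueWeight r 0 s x = (r * (1 - x)) ^ s / (s ! : ℝ) := by
  simp [queueWeight]

theorem queueWeight_succ_zero (r x : ℝ) (k : ℕ) :
    queueWeight r (k + 1) 0 x = (1 - x) * queueWeight r k 0 x := by
  simp only [queueWeight, pow_succ', add_mul, mul_assoc, map_add, PowerSeries.coeff_C_mul,
    PowerSeries.coeff_zero_X_mul, mul_zero, zero_add]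

theorem queueWeight_succ_succ (r x : ℝ) (k s : ℕ) :
    queueWeight r (k + 1) (s + 1) x =
      x * queueWeight r k s x + (1 - x) * queueWeight r k (s + 1) x := by
  simp only [queueWeight, pow_succ', add_mul, mul_assoc, map_add, PowerSeries.coeff_C_mul,
    PowerSeries.coeff_succ_X_mul]

theorem queueWeight_eq_sum (r x : ℝ) {k s : ℕ} (hks : k ≤ s) :
    queueWeight r k s x = ∑ j ∈ Finset.range (k + 1), (k.choose j : ℝ) *
      (r ^ (s - j) / ((s - j)! : ℝ)) * (x ^ j * (1 - x) ^ (k + s - 2 * j)) := by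
  unfold queueWeight
  rw [add_pow, Finset.sum_mul, map_sum]
  refine Finset.sum_congr rfl fun j hj => ?_
  have hj : j ≤ k := Nat.lt_succ_iff.1 (Finset.mem_range.1 hj)
  rw [mul_pow, ← map_pow, ← map_pow, ← map_natCast (PowerSeries.C (R := ℝ)),
    mul_right_comm _ (PowerSeries.X ^ j), mul_right_comm _ (PowerSeries.X ^ j),
    mul_assoc _ (PowerSeries.X ^ j), ← map_mul, ← map_mul, PowerSeries.coeff_C_mul,
    PowerSeries.coeff_X_pow_mul', if_pos (hj.trans hks), PowerSeries.coeff_mk, mul_pow,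
    show k + s - 2 * j = (k - j) + (s - j) by omega, pow_add]
  ring

theorem queueWeight_nonneg {r x : ℝ} (hr : 0 ≤ r) (h0 : 0 ≤ x) (h1 : x ≤ 1) (k s : ℕ) :
    0 ≤ queueWeight r k s x := by
  have h1' : 0 ≤ 1 - x := by linarith
  induction k generalizing s with
  | zero => rw [queueWeight_zero]; positivity
  | succ k ih =>
    cases s with
    | zero => rw [queueWeight_succ_zero]; exact mul_nonneg h1' (ih 0)
    | succ s =>
      rw [queueWeight_succ_succ]
      exact add_nonneg (mul_nonneg h0 (ih s)) (mul_nonneg h1' (ih (s + 1)))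

theorem queueWeight_pos {r x : ℝ} (hr : 0 < r) (h0 : 0 < x) (h1 : x < 1) (k s : ℕ) :
    0 < queueWeight r k s x := by
  have h1' : 0 < 1 - x := by linarith
  induction k with
  | zero => rw [queueWeight_zero]; positivity
  | succ k ih =>
    cases s with
    | zero => rw [queueWeight_succ_zero]; exact mul_pos h1' ih
    | succ s =>
      rw [queueWeight_succ_succ]
      exact add_pos_of_nonneg_of_pos
        (mul_nonneg h0.le (queueWeight_nonneg hr.le h0.le h1.le k s)) (mul_pos h1' ih)

/-- At `x = 1` the generating function is `X ^ k`. This kills the boundary term of the integration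
by parts, and is where `k < s` is needed. -/
theorem queueWeight_one {k s : ℕ} (r : ℝ) (hks : k < s) : queueWeight r k s 1 = 0 := by
  induction k generalizing s with
  | zero => rw [queueWeight_zero]; simp [hks.ne']
  | succ k ih =>
    obtain ⟨s, rfl⟩ : ∃ t, s = t + 1 := ⟨s - 1, by omega⟩
    rw [queueWeight_succ_succ, ih (by omega)]; simp

/-- `queueWeight` with the last index lowered by one, and `0` in place of the index `-1`. -/
noncomputable def queueWeightPred (r : ℝ) (k : ℕ) : ℕ → ℝ → ℝ
  | 0 => fun _ => 0
  | s + 1 => queueWeight r k s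

theorem queueWeight_succ (r x : ℝ) (k s : ℕ) :
    queueWeight r (k + 1) s x =
      x * queueWeightPred r k s x + (1 - x) * queueWeight r k s x := by
  cases s with
  | zero => simp [queueWeightPred, queueWeight_succ_zero]
  | succ s => simp [queueWeightPred, queueWeight_succ_succ]

/-- The generating function `G = (x z + 1 - x)^k e^{r (1 - x) z}` has `x`-derivative `-r z G + k (z
- 1) (x z + 1 - x)^(k-1) e^{r (1 - x) z}`, and multiplication by `z` lowers the index `s` by one.
For `k = 0` the truncated `k - 1` is harmless because of the factor `k`. -/
theorem hasDerivAt_queueWeight (r : ℝ) (k s : ℕ) (x : ℝ) :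
    HasDerivAt (queueWeight r k s)
      (-r * queueWeightPred r k s x +
        k * (queueWeightPred r (k - 1) s x - queueWeight r (k - 1) s x)) x := by
  have hlin : HasDerivAt (fun x : ℝ => 1 - x) (-1) x := by
    simpa using (hasDerivAt_id x).const_sub 1
  induction k generalizing s with
  | zero =>
    have h : queueWeight r 0 s = fun x => (r * (1 - x)) ^ s / (s ! : ℝ) :=
      funext fun x => queueWeight_zero r x s
    rw [h]
    refine (((hlin.const_mul r).fun_pow s).div_const _).congr_deriv ?_
    cases s with
    | zero => simp [queueWeightPred]
    | succ s =>
      have : (s ! : ℝ) ≠ 0 := by positivity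
      simp [queueWeightPred, queueWeight_zero, Nat.factorial_succ]
      field_simp
  | succ k ih =>
    have hpred : HasDerivAt (queueWeightPred r k s)
        (match s with
          | 0 => 0
          | s + 1 => -r * queueWeightPred r k s x +
              k * (queueWeightPred r (k - 1) s x - queueWeight r (k - 1) s x)) x := by
      cases s with
      | zero => exact hasDerivAt_const x 0
      | succ s => exact ih s
    have h : queueWeight r (k + 1) s =
        fun x => x * queueWeightPred r k s x + (1 - x) * queueWeight r k s x :=
      funext fun x => queueWeight_succ r x k s
    rw [h]
    refine (((hasDerivAt_id x).mul hpred).add (hlin.mul (ih s))).congr_deriv ?_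
    cases s with
    | zero =>
      cases k with
      | zero => simp [queueWeightPred, queueWeight_zero]
      | succ k =>
        simp [queueWeightPred, queueWeight_succ]
        ring
    | succ s =>
      cases k with
      | zero =>
        simp [queueWeightPred, queueWeight_succ, queueWeight_zero]
        ring
      | succ k =>
        simp [queueWeightPred, queueWeight_succ]
        ring

theorem continuous_queueWeight (r : ℝ) (k s : ℕ) : Continuous (queueWeight r k s) :=
  continuous_iff_continuousAt.2 fun x => (hasDerivAt_queueWeight r k s x).continuousAt

theorem continuous_queueWeightPred (r : ℝ) (k s : ℕ) : Continuous (queueWeightPred r k s) := by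
  cases s with
  | zero => exact continuous_const
  | succ s => exact continuous_queueWeight r k s

/-- With `r = λ / μ` and `c = q / μ` this is the eigenvalue equation of the generator divided by
`μ`. `queueWeight_succ`, used at `k` and at `k - 1`, eliminates the index `s - 1` from the
integrated derivative. -/
theorem betaExpIntegral_queueWeight_recurrence {c : ℝ} (hc : 0 < c) (r : ℝ) {k s : ℕ}
    (hks : k < s) :
    r * betaExpIntegral c r (queueWeight r (k + 1) s) +
        k * betaExpIntegral c r (queueWeight r (k - 1) s) =
      (r + k + c) * betaExpIntegral c r (queueWeight r k s) := by
  have cw := continuous_queueWeight r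
  have cp := continuous_queueWeightPred r
  have h := betaExpIntegral_deriv hc r
    (f' := fun x => -r * queueWeightPred r k s x +
        k * (queueWeightPred r (k - 1) s x - queueWeight r (k - 1) s x)) (by fun_prop)
    (hasDerivAt_queueWeight r k s)
  rw [queueWeight_one r hks] at h
  have hfun : (fun x => c * queueWeight r k s x + (x * (-r * queueWeightPred r k s x +
        k * (queueWeightPred r (k - 1) s x - queueWeight r (k - 1) s x)) +
        r * (x * queueWeight r k s x))) =
      fun x => (r + k + c) * queueWeight r k s x + (-r * queueWeight r (k + 1) s x +
        -k * queueWeight r (k - 1) s x) := by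
    ext x
    cases k with
    | zero => simp [queueWeight_succ]; ring
    | succ k => simp [queueWeight_succ]; ring
  rw [hfun, betaExpIntegral_add hc r (by fun_prop) (by fun_prop),
    betaExpIntegral_add hc r (by fun_prop) (by fun_prop), betaExpIntegral_const_mul,
    betaExpIntegral_const_mul, betaExpIntegral_const_mul] at h
  linarith

theorem queueWeight_eq_sum_sum (r x : ℝ) {k s : ℕ} (hks : k ≤ s) :
    queueWeight r k s x = ∑ j ∈ Finset.range (k + 1), ∑ m ∈ Finset.range (k + s - 2 * j + 1),
      ((k.choose j : ℝ) * ((k + s - 2 * j).choose m : ℝ) *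
            (r ^ (s - j) * (-1) ^ m / ((s - j)! : ℝ))) * x ^ (j + m) := by
  rw [queueWeight_eq_sum r x hks]
  refine Finset.sum_congr rfl fun j _ => ?_
  rw [show (1 : ℝ) - x = -x + 1 by ring, add_pow, Finset.mul_sum, Finset.mul_sum]
  refine Finset.sum_congr rfl fun m _ => ?_
  rw [neg_pow, pow_add]
  ring

/-- The power `x ^ (j + m)` shifts `c = q / mu` to `c + j + m`, and the fraction `q / (q + (j + m)
mu) = c / (c + j + m)` cancels the factor in Euler's integral. -/
theorem sum_kummerM_eq_betaExpIntegral {mu q r : ℝ} (hmu : 0 < mu) (hq : 0 < q) (hr : 0 ≤ r)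
    {k s : ℕ} (hks : k ≤ s) :
    (∑ j ∈ Finset.range (k + 1), ∑ m ∈ Finset.range (k + s - 2 * j + 1),
          (k.choose j : ℝ) * ((k + s - 2 * j).choose m : ℝ) *
            (r ^ (s - j) * (-1) ^ m / ((s - j)! : ℝ)) * (q / (q + ((j : ℝ) + m) * mu)) *
            kummerM 1 (q / mu + j + m + 1) (-r)) =
      q / mu * betaExpIntegral (q / mu) r (queueWeight r k s) := by
  have hc : 0 < q / mu := div_pos hq hmu
  rw [show queueWeight r k s = _ from funext fun x => queueWeight_eq_sum_sum r x hks,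
    betaExpIntegral_sum hc r _ (fun j => by fun_prop), Finset.mul_sum]
  refine Finset.sum_congr rfl fun j _ => ?_
  rw [betaExpIntegral_sum hc r _ (fun j => by fun_prop), Finset.mul_sum]
  refine Finset.sum_congr rfl fun m _ => ?_
  rw [betaExpIntegral_const_mul, betaExpIntegral_pow]
  have hb : q / mu + ((j + m : ℕ) : ℝ) = q / mu + j + m := by push_cast; ring
  rw [hb, kummerM_one_eq (by positivity) hr]
  field_simp
  ring

/-! ### The generator below `s` -/

theorem sum_birthDeathGenerator_mul (birth death : ℕ → ℝ) (f : ℕ → ℝ) {i s : ℕ} (his : i < s) :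
    ∑ j ∈ Finset.range (s + 1), birthDeathGenerator birth death i j * f j =
      birth i * (f (i + 1) - f i) + if i = 0 then 0 else death i * (f (i - 1) - f i) := by
  -- For `i = 0` the truncated `i - 1` equals `i`; the inner guard makes that term vanish.
  have h (j : ℕ) : birthDeathGenerator birth death i j * f j =
      (if j = i + 1 then birth i * f j else 0) +
      (if j = i - 1 then (if i = 0 then 0 else death i * f j) else 0) +
      (if j = i then -(birth i + if i = 0 then 0 else death i) * f j else 0) := by
    unfold birthDeathGenerator
    by_cases h1 : j = i + 1
    · have h2 : ¬ j = i - 1 := by omega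
      have h3 : ¬ j = i := by omega
      rw [if_pos h1, if_pos h1, if_neg h2, if_neg h3]; ring
    · by_cases h2 : j + 1 = i
      · have h3 : j = i - 1 := by omega
        have h4 : ¬ j = i := by omega
        have h5 : ¬ i = 0 := by omega
        rw [if_neg h1, if_pos h2, if_neg h1, if_pos h3, if_neg h4, if_neg h5]; ring
      · rw [if_neg h1, if_neg h2, if_neg h1]
        by_cases h3 : j = i - 1
        · have h4 : i = 0 := by omega
          have h5 : j = i := by omega
          simp only [if_pos h3, if_pos h4, if_pos h5]; ring
        · rw [if_neg h3]
          split_ifs <;> ring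
  have h1 : i + 1 < s + 1 := by omega
  have h2 : i - 1 < s + 1 := by omega
  have h3 : i < s + 1 := by omega
  simp only [h, Finset.sum_add_distrib, Finset.sum_ite_eq', Finset.mem_range, if_pos h1, if_pos h2,
    if_pos h3]
  split_ifs <;> ring

/-- The function equal to `g` on `{0, …, s}` and to `c` beyond `s`. -/
noncomputable def extendByConst (s : ℕ) (c : ℝ) (g : ℕ → ℝ) (i : ℕ) : ℝ := if i ≤ s then g i else c

/-- A constant plus finitely many indicators: its mean after a step needs only finitely many
transition probabilities, so the entrywise rates suffice. -/
theorem extendByConst_eq_sum (s : ℕ) (c : ℝ) (g : ℕ → ℝ) (i : ℕ) :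
    extendByConst s c g i =
      c + ∑ j ∈ Finset.range (s + 1), (g j - c) * if i = j then 1 else 0 := by
  simp only [mul_ite, mul_one, mul_zero, Finset.sum_ite_eq, Finset.mem_range, extendByConst,
    Nat.lt_succ_iff]
  split_ifs <;> ring

theorem abs_extendByConst_le (s : ℕ) (c : ℝ) (g : ℕ → ℝ) (i : ℕ) :
    |extendByConst s c g i| ≤ |c| + ∑ j ∈ Finset.range (s + 1), |g j| := by
  unfold extendByConst
  split_ifs with h
  · have := Finset.single_le_sum (f := fun j => |g j|) (fun _ _ => abs_nonneg _)
      (Finset.mem_range.2 (Nat.lt_succ_of_le h))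
    have := abs_nonneg c
    linarith
  · have := Finset.sum_nonneg (s := Finset.range (s + 1)) fun j _ => abs_nonneg (g j)
    linarith

/-! ### Discounted values on a time grid -/

/-- For a sequence `x` observed at the times `0, h, 2 h, …`, the discounted value of `w` at the
first entrance into `{s, s + 1, …}` or at the `N`-th time, whichever comes first, written as a
telescoping sum. -/
noncomputable def stoppedValueSum (q h : ℝ) (s : ℕ) (w : ℕ → ℝ) (x : ℕ → ℕ) (N : ℕ) : ℝ :=
  w (x 0) + ∑ m ∈ Finset.range N, if ∀ l ≤ m, x l < s then
    Real.exp (-(q * h)) ^ (m + 1) * w (x (m + 1)) - Real.exp (-(q * h)) ^ m * w (x m) else 0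

/-- Increments before `M` telescope and later ones vanish; `M` is the entrance index or the horizon.
-/
theorem stoppedValueSum_eq (q h : ℝ) (s : ℕ) (w : ℕ → ℝ) (x : ℕ → ℕ) {M N : ℕ} (hMN : M ≤ N)
    (hlt : ∀ l < M, x l < s) (hM : M = N ∨ s ≤ x M) :
    stoppedValueSum q h s w x N = Real.exp (-(q * h)) ^ M * w (x M) := by
  have hsum : ∀ K, M ≤ K → K ≤ N → stoppedValueSum q h s w x K = stoppedValueSum q h s w x M := by
    intro K hK
    induction K, hK using Nat.le_induction with
    | base => intro _; rfl
    | succ K hK ih =>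
      intro hKN
      rw [← ih (by omega)]
      have : ¬ ∀ l ≤ K, x l < s := by
        intro hall
        rcases hM with rfl | hM
        · omega
        · exact absurd (hall M hK) (by omega)
      rw [stoppedValueSum, Finset.sum_range_succ, if_neg this, add_zero, ← stoppedValueSum]
  rw [hsum N hMN le_rfl, stoppedValueSum, Finset.sum_congr rfl fun m hm => if_pos ?_,
    Finset.sum_range_sub fun m => Real.exp (-(q * h)) ^ m * w (x m)]
  · simp
  · intro l hl
    exact hlt l (hl.trans_lt (Finset.mem_range.1 hm))

theorem abs_stoppedValueSum_le {q h : ℝ} (hqh : 0 ≤ q * h) (s : ℕ) {w : ℕ → ℝ} {B : ℝ}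
    (hw : ∀ i, |w i| ≤ B) (x : ℕ → ℕ) (N : ℕ) : |stoppedValueSum q h s w x N| ≤ B := by
  have hex : ∃ m, m = N ∨ s ≤ x m := ⟨N, Or.inl rfl⟩
  have hmin {l : ℕ} (hl : l < Nat.find hex) : x l < s := by
    have := Nat.find_min hex hl
    push Not at this
    exact this.2
  rw [stoppedValueSum_eq q h s w x (Nat.find_min' hex (Or.inl rfl)) (fun l => hmin)
    (Nat.find_spec hex), abs_mul, abs_of_nonneg (by positivity)]
  have h1 : Real.exp (-(q * h)) ^ Nat.find hex ≤ 1 :=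
    pow_le_one₀ (Real.exp_pos _).le (Real.exp_le_one_iff.2 (by linarith))
  calc _ ≤ 1 * |w (x (Nat.find hex))| := by gcongr
    _ ≤ B := by rw [one_mul]; exact hw _

theorem measurable_stoppedValueSum {Ω : Type*} [MeasurableSpace Ω] (q h : ℝ) (s : ℕ) (w : ℕ → ℝ)
    {X : ℕ → Ω → ℕ} (hX : ∀ m, Measurable (X m)) (N : ℕ) :
    Measurable fun ω => stoppedValueSum q h s w (fun m => X m ω) N := by
  have hw (m : ℕ) : Measurable fun ω => w (X m ω) := measurable_from_top.comp (hX m)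
  unfold stoppedValueSum
  refine (hw 0).add (Finset.measurable_fun_sum _ fun m _ => Measurable.ite ?_ ?_ measurable_const)
  · simp only [Set.ofPred_forall]
    exact MeasurableSet.iInter fun l => MeasurableSet.iInter fun _ =>
      measurableSet_lt (hX l) measurable_const
  · exact ((hw _).const_mul _).sub ((hw _).const_mul _)

/-! ### Right-continuous paths and refinement of the grid -/

section Path

variable {q : ℝ} {s : ℕ} {w : ℕ → ℝ} {y : ℝ≥0 → ℕ}

theorem eventually_eq_of_rightContinuous {t : ℝ≥0} (hy : ContinuousWithinAt y (Set.Ici t) t) :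
    ∀ᶠ u in 𝓝[≥] t, y u = y t := by
  have := hy.eventually (p := fun n => n = y t) (by simp)
  exact this

theorem sInf_mem_of_rightContinuous (hy : ∀ t, ContinuousWithinAt y (Set.Ici t) t)
    (hne : {t | s ≤ y t}.Nonempty) : s ≤ y (sInf {t | s ≤ y t}) := by
  have hcl := csInf_mem_closure hne (OrderBot.bddBelow _)
  rw [mem_closure_iff_frequently] at hcl
  have hev := eventually_eq_of_rightContinuous (hy (sInf {t | s ≤ y t}))
  rw [eventually_nhdsWithin_iff] at hev
  obtain ⟨u, hu, hu'⟩ := (hcl.and_eventually hev).exists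
  rw [← hu' (csInf_le (OrderBot.bddBelow _) hu)]
  exact hu

theorem tendsto_stoppedValueSum_of_hit (hy : ∀ t, ContinuousWithinAt y (Set.Ici t) t) {t : ℝ≥0}
    (ht : s ≤ y t) (hlt : ∀ u < t, y u < s) :
    Tendsto (fun n : ℕ => stoppedValueSum q (((n : ℝ≥0) + 1)⁻¹ : ℝ≥0) s w
      (fun m => y (m * ((n : ℝ≥0) + 1)⁻¹)) ((n + 1) ^ 2)) atTop
      (𝓝 (Real.exp (-(q * t)) * w (y t))) := by
  -- The first grid index at or after `t`. The grid times `u n` approach `t` from the right, where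
  -- the path is locally constant.
  set M : ℕ → ℕ := fun n => ⌈t * ((n : ℝ≥0) + 1)⌉₊ with hM
  set u : ℕ → ℝ≥0 := fun n => M n * ((n : ℝ≥0) + 1)⁻¹ with hu
  have hpos (n : ℕ) : (0 : ℝ≥0) < (n : ℝ≥0) + 1 := by positivity
  have hge (n : ℕ) : t ≤ u n := by
    simp only [hu]
    rw [← div_eq_mul_inv, le_div_iff₀ (hpos n)]
    exact Nat.le_ceil _
  have hle (n : ℕ) : u n ≤ t + ((n : ℝ≥0) + 1)⁻¹ := by
    have h1 : (M n : ℝ≥0) ≤ t * ((n : ℝ≥0) + 1) + 1 := (Nat.ceil_lt_add_one zero_le).le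
    calc u n ≤ (t * ((n : ℝ≥0) + 1) + 1) * ((n : ℝ≥0) + 1)⁻¹ := by
          simp only [hu]; gcongr
      _ = t + ((n : ℝ≥0) + 1)⁻¹ := by
          rw [add_mul, mul_inv_cancel_right₀ (hpos n).ne', one_mul]
  have hlim0 : Tendsto (fun n : ℕ => ((n : ℝ≥0) + 1)⁻¹) atTop (𝓝 0) := by
    rw [← NNReal.tendsto_coe]
    simpa [one_div] using tendsto_one_div_add_atTop_nhds_zero_nat (𝕜 := ℝ)
  have hlim : Tendsto u atTop (𝓝 t) :=
    tendsto_of_tendsto_of_tendsto_of_le_of_le tendsto_const_nhds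
      (by simpa using tendsto_const_nhds.add hlim0) hge hle
  have hlim' : Tendsto u atTop (𝓝[≥] t) :=
    tendsto_nhdsWithin_iff.2 ⟨hlim, Eventually.of_forall hge⟩
  have hev : ∀ᶠ n in atTop, y (u n) = y t :=
    hlim'.eventually (eventually_eq_of_rightContinuous (hy t))
  have hexp : Tendsto (fun n => Real.exp (-(q * u n)) * w (y t)) atTop
      (𝓝 (Real.exp (-(q * t)) * w (y t))) := by
    have : Tendsto (fun n => (u n : ℝ)) atTop (𝓝 t) := NNReal.tendsto_coe.2 hlim
    exact ((Real.continuous_exp.tendsto _).comp (this.const_mul q).neg).mul_const _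
  refine hexp.congr' ?_
  filter_upwards [hev, eventually_ge_atTop ⌈t⌉₊] with n hn hnt
  have htn : t ≤ n := Nat.ceil_le.1 hnt
  rw [stoppedValueSum_eq q _ s w _ (M := M n)]
  · change _ = _ * w (y (u n))
    rw [hn, ← Real.exp_nat_mul]
    congr 2
    simp only [hu]
    push_cast
    ring
  · rw [hM, Nat.ceil_le]
    push_cast
    rw [sq]
    gcongr
    exact htn.trans (by simp)
  · intro l hl
    apply hlt
    rw [← div_eq_mul_inv, div_lt_iff₀ (hpos n)]
    exact Nat.lt_ceil.1 hl
  · right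
    change s ≤ y (u n)
    rw [hn]; exact ht

/-- `(n + 1)^2` steps of length `1 / (n + 1)` reach time `n + 1`, where the discount is `e^{-q (n +
1)}`. -/
theorem tendsto_stoppedValueSum_of_not_hit (hq : 0 < q) (hlt : ∀ u, y u < s) {B : ℝ}
    (hw : ∀ i, |w i| ≤ B) :
    Tendsto (fun n : ℕ => stoppedValueSum q (((n : ℝ≥0) + 1)⁻¹ : ℝ≥0) s w
      (fun m => y (m * ((n : ℝ≥0) + 1)⁻¹)) ((n + 1) ^ 2)) atTop (𝓝 0) := by
  have hlim : Tendsto (fun n : ℕ => Real.exp (-(q * ((n : ℝ) + 1))) * B) atTop (𝓝 0) := by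
    have h1 : Tendsto (fun n : ℕ => q * ((n : ℝ) + 1)) atTop atTop :=
      (tendsto_atTop_add_const_right _ _ tendsto_natCast_atTop_atTop).const_mul_atTop hq
    simpa using (Real.tendsto_exp_neg_atTop_nhds_zero.comp h1).mul_const B
  refine squeeze_zero_norm (fun n => ?_) hlim
  rw [stoppedValueSum_eq q _ s w _ le_rfl (fun l _ => hlt _) (Or.inl rfl), norm_mul,
    Real.norm_of_nonneg (by positivity), ← Real.exp_nat_mul]
  have hn : (n : ℝ) + 1 ≠ 0 := by positivity
  have : ((((n + 1) ^ 2 : ℕ) : ℝ) * -(q * ((((n : ℝ≥0) + 1)⁻¹ : ℝ≥0) : ℝ))) =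
      -(q * ((n : ℝ) + 1)) := by
    push_cast
    field_simp
  rw [this]
  gcongr
  exact hw _

open scoped Classical in
/-- The value of `w` at the first entrance of the path `y` into `{s, s + 1, …}`, discounted. -/
noncomputable def discountedEntrance (q : ℝ) (s : ℕ) (w : ℕ → ℝ) (y : ℝ≥0 → ℕ) : ℝ :=
  if ∃ t, s ≤ y t then
    Real.exp (-(q * (sInf {t | s ≤ y t} : ℝ≥0))) * w (y (sInf {t | s ≤ y t})) else 0

theorem tendsto_stoppedValueSum (hq : 0 < q) (hy : ∀ t, ContinuousWithinAt y (Set.Ici t) t) {B : ℝ}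
    (hw : ∀ i, |w i| ≤ B) :
    Tendsto (fun n : ℕ => stoppedValueSum q (((n : ℝ≥0) + 1)⁻¹ : ℝ≥0) s w
      (fun m => y (m * ((n : ℝ≥0) + 1)⁻¹)) ((n + 1) ^ 2)) atTop
      (𝓝 (discountedEntrance q s w y)) := by
  unfold discountedEntrance
  split_ifs with h
  · refine tendsto_stoppedValueSum_of_hit hy (sInf_mem_of_rightContinuous hy h) fun u hu => ?_
    exact not_le.1 (notMem_of_lt_csInf (s := {t | s ≤ y t}) hu (OrderBot.bddBelow _))
  · push Not at h
    exact tendsto_stoppedValueSum_of_not_hit hq h hw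

end Path

/-- If the path enters `{s, s + 1, …}` at `s`, the three values coincide. If it enters above `s`,
the bounds are 0 and the discount at entrance, which cannot come after the first visit to `s`. -/
theorem expDiscount_mem_Icc {Ω : Type*} {q : ℝ} (hq : 0 < q) {s : ℕ} {g : ℕ → ℝ} (hg : g s = 1)
    {Q : ℝ≥0 → Ω → ℕ} {ω : Ω} (hy : ∀ t, ContinuousWithinAt (fun u => Q u ω) (Set.Ici t) t) :
    expDiscount q (hittingAfter Q {s} 0 ω) ∈
      Set.Icc (discountedEntrance q s (extendByConst s 0 g) fun t => Q t ω)
        (discountedEntrance q s (extendByConst s 1 g) fun t => Q t ω) := by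
  unfold discountedEntrance
  by_cases h : ∃ t, s ≤ Q t ω
  · rw [if_pos h, if_pos h]
    set t := sInf {t | s ≤ Q t ω} with ht
    have hst : s ≤ Q t ω := sInf_mem_of_rightContinuous hy h
    have hle {u : ℝ≥0} (hu : s ≤ Q u ω) : t ≤ u := csInf_le (OrderBot.bddBelow _) hu
    rcases hst.eq_or_lt with heq | hlt
    · have hhit : hittingAfter Q {s} 0 ω = (t : WithTop ℝ≥0) := by
        rw [hittingAfter, if_pos ⟨t, zero_le, heq.symm⟩]
        congr 1
        apply IsLeast.csInf_eq
        exact ⟨⟨zero_le, heq.symm⟩, fun u hu => hle (le_of_eq hu.2.symm)⟩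
      simp only [hhit, ← heq, extendByConst, le_refl, if_true, hg, mul_one, Set.Icc_self]
      rfl
    · simp only [extendByConst, if_neg (not_le.2 hlt), mul_zero, mul_one]
      rw [hittingAfter]
      split_ifs with hh
      · have : t ≤ sInf {i : ℝ≥0 | 0 ≤ i ∧ Q i ω ∈ ({s} : Set ℕ)} :=
          le_csInf hh fun u hu => hle (le_of_eq hu.2.symm)
        refine ⟨(Real.exp_pos _).le, Real.exp_le_exp.2 ?_⟩
        have : (t : ℝ) ≤ (sInf {i : ℝ≥0 | 0 ≤ i ∧ Q i ω ∈ ({s} : Set ℕ)} : ℝ≥0) := by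
          exact_mod_cast this
        nlinarith
      · exact ⟨le_rfl, (Real.exp_pos _).le⟩
  · rw [if_neg h, if_neg h]
    push Not at h
    have : hittingAfter Q {s} 0 ω = ⊤ :=
      hittingAfter_eq_top_iff.2 fun j _ hj => (h j).ne hj
    rw [this]
    simp [expDiscount]

/-! ### Transition kernels over a short time -/

/-- The defect of `g` (extended by `c` beyond `s`) from being an eigenfunction, with eigenvalue
`exp (q h)`, of a transition kernel, in the state `i`. -/
noncomputable def kernelDefect (q : ℝ) (s : ℕ) (c : ℝ) (g : ℕ → ℝ) (p : ℝ≥0 → Kernel ℕ ℕ) (h : ℝ≥0)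
    (i : ℕ) : ℝ :=
  Real.exp (-(q * h)) * (c + ∑ j ∈ Finset.range (s + 1), (g j - c) * (p h i).real {j}) - g i

theorem tendsto_one_sub_exp_div {q : ℝ} :
    Tendsto (fun h : ℝ≥0 => (1 - Real.exp (-(q * h))) / h) (𝓝[>] 0) (𝓝 q) := by
  have hd : HasDerivAt (fun x : ℝ => 1 - Real.exp (-(q * x))) q 0 := by
    have := (((hasDerivAt_id (0 : ℝ)).const_mul q).neg.exp).const_sub 1
    simpa using this
  have ht := (hasDerivAt_iff_tendsto_slope_zero.1 hd)
  have hcoe : Tendsto (fun h : ℝ≥0 => (h : ℝ)) (𝓝[>] 0) (𝓝[≠] 0) := by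
    refine tendsto_nhdsWithin_iff.2 ⟨?_, ?_⟩
    · exact (NNReal.continuous_coe.tendsto' 0 0 rfl).mono_left nhdsWithin_le_nhds
    · filter_upwards [self_mem_nhdsWithin] with h hh
      exact_mod_cast (ne_of_gt hh)
  refine (ht.comp hcoe).congr fun h => ?_
  simp [div_eq_inv_mul]

theorem tendsto_kernelDefect_div {q : ℝ} {s : ℕ} {g : ℕ → ℝ} {birth death : ℕ → ℝ}
    {p : ℝ≥0 → Kernel ℕ ℕ} (hp : IsBirthDeathSemigroup birth death p) (c : ℝ) {i : ℕ} (hi : i < s)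
    (hg : ∑ j ∈ Finset.range (s + 1), birthDeathGenerator birth death i j * g j = q * g i) :
    Tendsto (fun h : ℝ≥0 => kernelDefect q s c g p h i / h) (𝓝[>] 0) (𝓝 0) := by
  have hexp : Tendsto (fun h : ℝ≥0 => Real.exp (-(q * h))) (𝓝[>] 0) (𝓝 1) := by
    have : Continuous fun h : ℝ≥0 => Real.exp (-(q * h)) := by fun_prop
    exact (this.tendsto' 0 1 (by simp)).mono_left nhdsWithin_le_nhds
  have hsum : Tendsto (fun h : ℝ≥0 => ∑ j ∈ Finset.range (s + 1), (g j - c) *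
      (((p h i).real {j} - if i = j then 1 else 0) / (h : ℝ))) (𝓝[>] 0)
      (𝓝 (∑ j ∈ Finset.range (s + 1), (g j - c) * birthDeathGenerator birth death i j)) :=
    tendsto_finsetSum _ fun j _ => (hp.rates i j).const_mul _
  -- For `i < s` the generator row is supported in `{0, …, s}` and sums to 0, so `c` drops out.
  have hlim : ∑ j ∈ Finset.range (s + 1), (g j - c) * birthDeathGenerator birth death i j =
      q * g i := by
    have h1 := sum_birthDeathGenerator_mul birth death (fun _ => c) hi
    simp only [sub_self, mul_zero, ite_self, add_zero] at h1
    rw [← hg, ← sub_zero (∑ j ∈ _, _ * g j), ← h1, ← Finset.sum_sub_distrib]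
    exact Finset.sum_congr rfl fun j _ => by ring
  have key := ((tendsto_one_sub_exp_div (q := q)).neg.mul_const (g i)).add (hexp.mul hsum)
  rw [hlim, one_mul, neg_mul, neg_add_cancel] at key
  refine key.congr fun h => ?_
  have h1 := extendByConst_eq_sum s c g i
  rw [extendByConst, if_pos hi.le] at h1
  have h2 : ∑ j ∈ Finset.range (s + 1), (g j - c) *
      (((p h i).real {j} - if i = j then 1 else 0) / (h : ℝ)) =
      (∑ j ∈ Finset.range (s + 1), (g j - c) * (p h i).real {j} -
        ∑ j ∈ Finset.range (s + 1), (g j - c) * if i = j then 1 else 0) / h := by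
    rw [← Finset.sum_sub_distrib, Finset.sum_div]
    exact Finset.sum_congr rfl fun j _ => by ring
  rw [h2, kernelDefect, ← sub_eq_of_eq_add' h1]
  ring

/-! ### Mean discount at first passage -/

section FirstPassage

variable {Ω : Type*} [MeasurableSpace Ω] {P : Measure Ω} [IsProbabilityMeasure P]
  {Q : ℝ≥0 → Ω → ℕ} {q : ℝ} {s k : ℕ} {g : ℕ → ℝ} {p : ℝ≥0 → Kernel ℕ ℕ}

/-- Absence of entrance up to time `m h` is an event of the history, so the Markov property applies
on each `Q (m h) = i`, `i < s`. -/
theorem integral_stoppedValueSum_increment (hQ : ∀ t, Measurable (Q t))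
    (hmarkov : ∀ (t h : ℝ≥0) (A : Set Ω),
      MeasurableSet[⨆ u ≤ t, MeasurableSpace.comap (Q u) ⊤] A →
      ∀ i j : ℕ, P (A ∩ {ω | Q t ω = i} ∩ {ω | Q (t + h) ω = j}) =
        P (A ∩ {ω | Q t ω = i}) * p h i {j}) (c : ℝ) (h : ℝ≥0) (m : ℕ) :
    ∫ ω, (if ∀ l : ℕ, l ≤ m → Q (l * h) ω < s then
        Real.exp (-(q * h)) ^ (m + 1) * extendByConst s c g (Q ((m + 1 : ℕ) * h) ω) -
          Real.exp (-(q * h)) ^ m * extendByConst s c g (Q (m * h) ω) else 0) ∂P =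
      ∑ i ∈ Finset.range s, Real.exp (-(q * h)) ^ m *
        (P.real ({ω | ∀ l : ℕ, l ≤ m → Q (l * h) ω < s} ∩ {ω | Q (m * h) ω = i}) *
          kernelDefect q s c g p h i) := by
  set e := Real.exp (-(q * h)) with he
  set A : Set Ω := {ω | ∀ l : ℕ, l ≤ m → Q (l * h) ω < s} with hA
  have hA' : MeasurableSet[⨆ u ≤ m * h, MeasurableSpace.comap (Q u) ⊤] A := by
    simp only [hA, Set.ofPred_forall]
    refine MeasurableSet.iInter fun l => MeasurableSet.iInter fun hl => ?_
    have hle : (l : ℝ≥0) * h ≤ m * h := by gcongr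
    exact (le_iSup₂ (f := fun u (_ : u ≤ m * h) => MeasurableSpace.comap (Q u) ⊤) _ hle) _
      ⟨Set.Iio s, trivial, rfl⟩
  have hAm : MeasurableSet A := by
    refine (iSup₂_le fun u _ => ?_ : (⨆ u ≤ m * h, MeasurableSpace.comap (Q u) ⊤) ≤ _) _ hA'
    exact (hQ u).comap_le
  have hsing (t : ℝ≥0) (i : ℕ) : MeasurableSet {ω | Q t ω = i} := hQ t (measurableSet_singleton i)
  have hmk (i j : ℕ) : P.real (A ∩ {ω | Q (m * h) ω = i} ∩ {ω | Q ((m + 1 : ℕ) * h) ω = j}) =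
      P.real (A ∩ {ω | Q (m * h) ω = i}) * (p h i).real {j} := by
    have := hmarkov (m * h) h A hA' i j
    rw [show (m : ℝ≥0) * h + h = (m + 1 : ℕ) * h by push_cast; ring] at this
    simp only [measureReal_def, this, ENNReal.toReal_mul]
  have hpt (ω : Ω) : (if ∀ l : ℕ, l ≤ m → Q (l * h) ω < s then
        e ^ (m + 1) * extendByConst s c g (Q ((m + 1 : ℕ) * h) ω) -
          e ^ m * extendByConst s c g (Q (m * h) ω) else 0) =
      ∑ i ∈ Finset.range s, e ^ m *
        (e * (c * (A ∩ {ω | Q (m * h) ω = i}).indicator 1 ω +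
          ∑ j ∈ Finset.range (s + 1), (g j - c) *
            (A ∩ {ω | Q (m * h) ω = i} ∩ {ω | Q ((m + 1 : ℕ) * h) ω = j}).indicator 1 ω) -
          g i * (A ∩ {ω | Q (m * h) ω = i}).indicator 1 ω) := by
    by_cases hω : ∀ l : ℕ, l ≤ m → Q (l * h) ω < s
    · have hmem : ω ∈ A := hω
      have hlt : Q (m * h) ω < s := hω m le_rfl
      rw [if_pos hω, Finset.sum_eq_single_of_mem (Q (m * h) ω) (Finset.mem_range.2 hlt)]
      · rw [extendByConst_eq_sum s c g (Q ((m + 1 : ℕ) * h) ω), extendByConst, if_pos hlt.le]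
        simp only [Set.indicator_apply, Set.mem_inter_iff, hmem, Set.mem_ofPred_eq, true_and,
          if_true, Pi.one_apply]
        ring
      · intro i _ hi
        simp [hi.symm]
    · have hmem : ω ∉ A := hω
      rw [if_neg hω]
      simp [hmem]
  have hint {S : Set Ω} (hS : MeasurableSet S) : Integrable (S.indicator (1 : Ω → ℝ)) P :=
    (integrable_const (1 : ℝ)).indicator hS
  have i1 (i : ℕ) := hint (hAm.inter (hsing (m * h) i))
  have i2 (i j : ℕ) := hint ((hAm.inter (hsing (m * h) i)).inter (hsing ((m + 1 : ℕ) * h) j))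
  have i3 (i : ℕ) : Integrable (fun ω => ∑ j ∈ Finset.range (s + 1), (g j - c) *
      (A ∩ {ω | Q (m * h) ω = i} ∩ {ω | Q ((m + 1 : ℕ) * h) ω = j}).indicator 1 ω) P :=
    integrable_finsetSum _ fun j _ => (i2 i j).const_mul _
  have i4 (i : ℕ) : Integrable (fun ω => e * (c * (A ∩ {ω | Q (m * h) ω = i}).indicator 1 ω +
      ∑ j ∈ Finset.range (s + 1), (g j - c) *
        (A ∩ {ω | Q (m * h) ω = i} ∩ {ω | Q ((m + 1 : ℕ) * h) ω = j}).indicator 1 ω)) P :=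
    (((i1 i).const_mul c).add (i3 i)).const_mul e
  simp only [hpt]
  rw [integral_finsetSum _ fun i _ => ?_]
  · refine Finset.sum_congr rfl fun i _ => ?_
    rw [integral_const_mul, integral_sub (i4 i) ((i1 i).const_mul _), integral_const_mul, integral_const_mul,
      integral_add ((i1 i).const_mul c) (i3 i), integral_const_mul,
      integral_finsetSum _ fun j _ => (i2 i j).const_mul _,
      integral_indicator_one (hAm.inter (hsing (m * h) i))]
    have hj (j : ℕ) : ∫ ω, (g j - c) * (A ∩ {ω | Q (m * h) ω = i} ∩
        {ω | Q ((m + 1 : ℕ) * h) ω = j}).indicator 1 ω ∂P =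
        P.real (A ∩ {ω | Q (m * h) ω = i}) * ((g j - c) * (p h i).real {j}) := by
      rw [integral_const_mul,
        integral_indicator_one ((hAm.inter (hsing (m * h) i)).inter (hsing _ j)), hmk]
      ring
    simp only [hj, ← Finset.mul_sum, kernelDefect]
    ring
  · exact ((i4 i).sub ((i1 i).const_mul _)).const_mul _

/-- Step `m` contributes at most `e^{-q h m}` times the total defect, and the geometric series
bounds the sum uniformly in `N`. -/
theorem abs_integral_stoppedValueSum_sub_le (hq : 0 < q) (hQ : ∀ t, Measurable (Q t))
    (hstart : ∀ᵐ ω ∂P, Q 0 ω = k)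
    (hmarkov : ∀ (t h : ℝ≥0) (A : Set Ω),
      MeasurableSet[⨆ u ≤ t, MeasurableSpace.comap (Q u) ⊤] A →
      ∀ i j : ℕ, P (A ∩ {ω | Q t ω = i} ∩ {ω | Q (t + h) ω = j}) =
        P (A ∩ {ω | Q t ω = i}) * p h i {j}) (c : ℝ) {h : ℝ≥0} (hh : 0 < h) (N : ℕ) :
    |∫ ω, stoppedValueSum q h s (extendByConst s c g) (fun m => Q (m * h) ω) N ∂P -
        extendByConst s c g k| ≤
      (∑ i ∈ Finset.range s, |kernelDefect q s c g p h i|) * (1 - Real.exp (-(q * h)))⁻¹ := by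
  have hh' : (0 : ℝ) < h := hh
  have he0 : 0 ≤ Real.exp (-(q * h)) := (Real.exp_pos _).le
  have he1 : Real.exp (-(q * h)) < 1 := Real.exp_lt_one_iff.2 (neg_lt_zero.2 (mul_pos hq hh'))
  have hmeas (N : ℕ) := measurable_stoppedValueSum q h s (extendByConst s c g)
    (X := fun m => Q (m * h)) (fun m => hQ _) N
  have hint (N : ℕ) : Integrable (fun ω =>
      stoppedValueSum q h s (extendByConst s c g) (fun m => Q (m * h) ω) N) P :=
    Integrable.of_bound (hmeas N).aestronglyMeasurable _ (Eventually.of_forall fun ω =>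
      abs_stoppedValueSum_le (by positivity) s (abs_extendByConst_le s c g) _ N)
  have hstep : |∫ ω, stoppedValueSum q h s (extendByConst s c g) (fun m => Q (m * h) ω) N ∂P -
      extendByConst s c g k| ≤
      ∑ m ∈ Finset.range N, Real.exp (-(q * h)) ^ m *
        ∑ i ∈ Finset.range s, |kernelDefect q s c g p h i| := by
    induction N with
    | zero =>
      have : ∫ ω, stoppedValueSum q h s (extendByConst s c g) (fun m => Q (m * h) ω) 0 ∂P =
          ∫ _, extendByConst s c g k ∂P := by
        refine integral_congr_ae (hstart.mono fun ω hω => ?_)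
        simp [stoppedValueSum, hω]
      rw [this]
      simp
    | succ N ih =>
      rw [Finset.sum_range_succ]
      have hdiff := integral_sub (hint (N + 1)) (hint N)
      have hincr := integral_stoppedValueSum_increment (q := q) (s := s) (g := g) hQ hmarkov c h N
      rw [integral_congr_ae (g := fun ω => if ∀ l : ℕ, l ≤ N → Q (l * h) ω < s then
        Real.exp (-(q * h)) ^ (N + 1) * extendByConst s c g (Q ((N + 1 : ℕ) * h) ω) -
          Real.exp (-(q * h)) ^ N * extendByConst s c g (Q (N * h) ω) else 0)
        (Eventually.of_forall fun ω => by
          simp only [stoppedValueSum, Finset.sum_range_succ]; ring), hincr] at hdiff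
      have hbound : |∑ i ∈ Finset.range s, Real.exp (-(q * h)) ^ N *
          (P.real ({ω | ∀ l : ℕ, l ≤ N → Q (l * h) ω < s} ∩ {ω | Q (N * h) ω = i}) *
            kernelDefect q s c g p h i)| ≤ Real.exp (-(q * h)) ^ N *
          ∑ i ∈ Finset.range s, |kernelDefect q s c g p h i| := by
        rw [Finset.mul_sum]
        refine (Finset.abs_sum_le_sum_abs _ _).trans (Finset.sum_le_sum fun i _ => ?_)
        rw [abs_mul, abs_mul, abs_of_nonneg (pow_nonneg he0 N), abs_of_nonneg measureReal_nonneg]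
        gcongr
        exact mul_le_of_le_one_left (abs_nonneg _) measureReal_le_one
      rw [hdiff] at hbound
      refine le_trans ?_ (add_le_add ih hbound)
      refine le_trans (le_of_eq ?_) (abs_add_le _ _)
      congr 1; ring
  refine hstep.trans ?_
  rw [← Finset.sum_mul, mul_comm]
  gcongr
  rw [← tsum_geometric_of_lt_one he0 he1]
  exact (summable_geometric_of_lt_one he0 he1).sum_le_tsum _ fun m _ => pow_nonneg he0 m

/-- The discounted first passage time to `s` of a birth-death process has, as a function of the
starting state, mean `g`, the solution with `g s = 1` of the eigenvalue equation of the generator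
below `s`. -/
theorem IsBirthDeathProcess.integral_expDiscount_hittingAfter {birth death : ℕ → ℝ}
    (hQ : IsBirthDeathProcess birth death k P Q) (hq : 0 < q) (hks : k ≤ s) (hgs : g s = 1)
    (hg : ∀ i < s, ∑ j ∈ Finset.range (s + 1), birthDeathGenerator birth death i j * g j =
      q * g i) :
    Integrable (fun ω => expDiscount q (hittingAfter Q {s} 0 ω)) P ∧
      ∫ ω, expDiscount q (hittingAfter Q {s} 0 ω) ∂P = g k := by
  obtain ⟨p, hp, hmarkov⟩ := hQ.markov
  set η : ℕ → ℝ≥0 := fun n => ((n : ℝ≥0) + 1)⁻¹ with hη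
  have hηpos (n : ℕ) : 0 < η n := by simp only [hη]; positivity
  have hηlim : Tendsto η atTop (𝓝[>] 0) := by
    refine tendsto_nhdsWithin_iff.2 ⟨?_, Eventually.of_forall hηpos⟩
    rw [← NNReal.tendsto_coe]
    simpa [hη, one_div] using tendsto_one_div_add_atTop_nhds_zero_nat (𝕜 := ℝ)
  set V : ℝ → ℕ → Ω → ℝ := fun c n ω => stoppedValueSum q (η n) s (extendByConst s c g)
    (fun m => Q (m * η n) ω) ((n + 1) ^ 2) with hV
  set W : ℝ → Ω → ℝ := fun c ω => discountedEntrance q s (extendByConst s c g) fun t => Q t ω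
    with hW
  have hVmeas (c : ℝ) (n : ℕ) : AEStronglyMeasurable (V c n) P :=
    (measurable_stoppedValueSum q _ s _ (fun m => hQ.measurable _) _).aestronglyMeasurable
  have hVbound (c : ℝ) (n : ℕ) (ω : Ω) : ‖V c n ω‖ ≤ |c| + ∑ j ∈ Finset.range (s + 1), |g j| :=
    abs_stoppedValueSum_le (by positivity) s (abs_extendByConst_le s c g) _ _
  have hVW (c : ℝ) : ∀ᵐ ω ∂P, Tendsto (fun n => V c n ω) atTop (𝓝 (W c ω)) :=
    hQ.rightContinuous.mono fun ω hω => tendsto_stoppedValueSum hq hω (abs_extendByConst_le s c g)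
  have hWmeas (c : ℝ) : AEStronglyMeasurable (W c) P :=
    aestronglyMeasurable_of_tendsto_ae atTop (hVmeas c) (hVW c)
  have hWint (c : ℝ) : Integrable (W c) P := by
    refine Integrable.of_bound (hWmeas c) (|c| + ∑ j ∈ Finset.range (s + 1), |g j|) ?_
    filter_upwards [hVW c] with ω hω
    exact le_of_tendsto hω.norm (Eventually.of_forall fun n => hVbound c n ω)
  have hlim1 (c : ℝ) : Tendsto (fun n => ∫ ω, V c n ω ∂P) atTop (𝓝 (∫ ω, W c ω ∂P)) :=
    tendsto_integral_of_dominated_convergence _ (hVmeas c) (integrable_const _)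
      (fun n => Eventually.of_forall (hVbound c n)) (hVW c)
  have hlim2 (c : ℝ) : Tendsto (fun n => ∫ ω, V c n ω ∂P) atTop (𝓝 (g k)) := by
    -- Both factors of the error bound are rescaled by `h`; they then tend to `0` and `1 / q`.
    have hzero : Tendsto (fun h : ℝ≥0 => (∑ i ∈ Finset.range s, |kernelDefect q s c g p h i / h|) *
        ((1 - Real.exp (-(q * h))) / h)⁻¹) (𝓝[>] 0) (𝓝 0) := by
      have h1 : Tendsto (fun h : ℝ≥0 => ∑ i ∈ Finset.range s, |kernelDefect q s c g p h i / h|)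
          (𝓝[>] 0) (𝓝 (∑ i ∈ Finset.range s, |(0 : ℝ)|)) :=
        tendsto_finsetSum _ fun i hi =>
          (tendsto_kernelDefect_div hp c (Finset.mem_range.1 hi) (hg i (Finset.mem_range.1 hi))).abs
      simpa using h1.mul (tendsto_one_sub_exp_div.inv₀ hq.ne')
    rw [tendsto_iff_norm_sub_tendsto_zero]
    refine squeeze_zero (fun _ => norm_nonneg _) (fun n => ?_) (hzero.comp hηlim)
    have hb := abs_integral_stoppedValueSum_sub_le (s := s) (g := g) hq hQ.measurable hQ.start
      hmarkov c (hηpos n) ((n + 1) ^ 2)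
    rw [extendByConst, if_pos hks] at hb
    refine hb.trans (le_of_eq ?_)
    have hne : (η n : ℝ) ≠ 0 := by exact_mod_cast (hηpos n).ne'
    simp only [Function.comp, abs_div, NNReal.abs_eq, ← Finset.sum_div]
    rw [inv_div, div_mul_div_comm, mul_comm ((η n : ℝ)), mul_div_mul_right _ _ hne, div_eq_mul_inv]
  have hWk (c : ℝ) : ∫ ω, W c ω ∂P = g k := tendsto_nhds_unique (hlim1 c) (hlim2 c)
  have hmem : ∀ᵐ ω ∂P, expDiscount q (hittingAfter Q {s} 0 ω) ∈ Set.Icc (W 0 ω) (W 1 ω) :=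
    hQ.rightContinuous.mono fun ω hω => expDiscount_mem_Icc hq hgs hω
  -- Ordered variables with equal means coincide almost surely.
  have hW01 : W 0 =ᵐ[P] W 1 := by
    refine (integral_eq_iff_of_ae_le (hWint 0) (hWint 1) ?_).1 ((hWk 0).trans (hWk 1).symm)
    filter_upwards [hmem] with ω hω using hω.1.trans hω.2
  have heq : (fun ω => expDiscount q (hittingAfter Q {s} 0 ω)) =ᵐ[P] W 1 := by
    filter_upwards [hmem, hW01] with ω hω h01
    exact le_antisymm hω.2 (h01 ▸ hω.1)
  exact ⟨(hWint 1).congr heq.symm, (integral_congr_ae heq).trans (hWk 1)⟩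

end FirstPassage

/-! ### Application to the two queues -/

/-- The eigenvalue equation below `s` of the generator of a birth-death process with constant birth
rate `lam` and death rates `n * mu` for `n ≤ s`. -/
theorem sum_birthDeathGenerator_mul_queueWeight {lam mu q : ℝ} (hmu : 0 < mu) (hq : 0 < q)
    {death : ℕ → ℝ} {s : ℕ} (hdeath : ∀ n ≤ s, death n = n * mu) (a : ℝ) {i : ℕ} (hi : i < s) :
    ∑ j ∈ Finset.range (s + 1), birthDeathGenerator (fun _ => lam) death i j *
        (betaExpIntegral (q / mu) (lam / mu) (queueWeight (lam / mu) j s) / a) =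
      q * (betaExpIntegral (q / mu) (lam / mu) (queueWeight (lam / mu) i s) / a) := by
  have hrec := betaExpIntegral_queueWeight_recurrence (div_pos hq hmu) (lam / mu) hi
  rw [sum_birthDeathGenerator_mul _ _ _ hi, hdeath i hi.le]
  have hif (b : ℝ) : (if i = 0 then 0 else (i : ℝ) * mu * b) = i * mu * b := by
    split_ifs with h
    · simp [h]
    · rfl
  rw [hif]
  field_simp at hrec ⊢
  linear_combination a⁻¹ * hrec

theorem lemma4p3 {Ω : Type*} [MeasurableSpace Ω] (P : Measure Ω) [IsProbabilityMeasure P]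
    (Q : ℝ≥0 → Ω → ℕ) (lam mu q rho : ℝ) (hlam : 0 < lam) (hmu : 0 < mu) (hq : 0 < q)
    (hrho : rho = lam / mu) (k s : ℕ) (hks : k ≤ s)
    (hQ : IsMMInfQueue lam mu k P Q ∨ IsMMsQueue s lam mu k P Q) :
    Integrable (fun ω => expDiscount q (hittingAfter Q {s} 0 ω)) P ∧
    ∫ ω, expDiscount q (hittingAfter Q {s} 0 ω) ∂P =
      (∑ j ∈ Finset.range (k + 1), ∑ m ∈ Finset.range (k + s - 2 * j + 1),
          (k.choose j : ℝ) * ((k + s - 2 * j).choose m : ℝ) *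
            (rho ^ (s - j) * (-1) ^ m / ((s - j)! : ℝ)) * (q / (q + ((j : ℝ) + m) * mu)) *
            kummerM 1 (q / mu + j + m + 1) (-rho)) /
        (∑ j ∈ Finset.range (s + 1), ∑ m ∈ Finset.range (2 * (s - j) + 1),
          (s.choose j : ℝ) * ((2 * (s - j)).choose m : ℝ) *
            (rho ^ (s - j) * (-1) ^ m / ((s - j)! : ℝ)) * (q / (q + ((j : ℝ) + m) * mu)) *
            kummerM 1 (q / mu + j + m + 1) (-rho)) := by
  subst hrho
  have hr : 0 < lam / mu := div_pos hlam hmu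
  have hc : 0 < q / mu := div_pos hq hmu
  set F : ℕ → ℝ := fun i => betaExpIntegral (q / mu) (lam / mu) (queueWeight (lam / mu) i s) with hF
  have hFs : F s ≠ 0 := (betaExpIntegral_pos hc _ (continuous_queueWeight _ _ _)
    fun x h0 h1 => queueWeight_pos hr h0 h1 s s).ne'
  obtain ⟨death, hdeath, hproc⟩ : ∃ death : ℕ → ℝ, (∀ n ≤ s, death n = n * mu) ∧
      IsBirthDeathProcess (fun _ => lam) death k P Q := by
    rcases hQ with hQ | hQ
    · exact ⟨_, fun n _ => rfl, hQ⟩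
    · exact ⟨_, fun n hn => by simp only [min_eq_left hn], hQ⟩
  have hden := sum_kummerM_eq_betaExpIntegral hmu hq hr.le (le_refl s)
  -- The general formula at `k = s` has `s + s - 2 * j` where the denominator has `2 * (s - j)`.
  simp only [← two_mul, ← Nat.mul_sub] at hden
  rw [sum_kummerM_eq_betaExpIntegral hmu hq hr.le hks, hden, mul_div_mul_left _ _ hc.ne']
  exact hproc.integral_expDiscount_hittingAfter (g := fun i => F i / F s) hq hks (div_self hFs)
    fun i hi => sum_birthDeathGenerator_mul_queueWeight hmu hq hdeath (F s) hi
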